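/- All graphs are finite, simple and undirected; $d$ is the shortest-path distance ($\infty$ between different components), and $N_\delta(v)=\{u : 1\le d(v,u)\le\delta\}$ for $\delta\in\mathbb N$. **Breadth-first colouring BFC-$\delta$.** For every vertex $v$ fix a breadth-first search from $v$ that visits $\{v\}\cup N_\delta(v)$, level by level (the level of $u$ being $d(v,u)$), with ties inside a level broken arbitrarily. A *tree edge* $(a,b)$ is an edge such that $b$ is discovered from $a$, the first visited neighbour of $b$, with $a$ visited before $b$; every other edge between visited vertices is a *back edge* and is directed from the later to the earlier vertex. Let $$\eta_v(u)=\{o : (o,u) \text{ is a tree edge, or } (u,o) \text{ is a back edge and } d(v,o)\ne d(v,u)\}.$$ Let $\rho:C\times\mathcal M(C)\to C$, $\phi:C\times C\to C$ and $\psi:\mathcal M(C)\to C$ be injective, where $C$ is a set of colours and $\mathcal M(C)$ is the set of finite multisets over $C$. Start with $\lambda^0(u)=\lambda^0_v(u)=c_0$ for a fixed colour $c_0$ and put $$\lambda_v^{l+1}(u)=\phi\bigl(\lambda^l(u),\psi(\{\!\!\{\lambda_v^l(w): w\in\eta_v(u)\}\!\!\})\bigr),\qquad \lambda^{l+1}(u)=\rho\bigl(\lambda^l(u),\{\!\!\{\lambda_v^{l+1}(u):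 v\in N_\delta(u)\}\!\!\}\bigr).$$ BFC-$\delta$ *distinguishes* $G$ and $H$ if $\{\!\!\{\lambda^l(u):u\in V_G\}\!\!\}\neq\{\!\!\{\lambda^l(u):u\in V_H\}\!\!\}$ for some $l$. **3-WL.** A triple of vertices initially gets as colour its pattern of equalities and adjacencies. In each round the new colour of $(v_1,v_2,v_3)$ consists of its old colour and, for each $i\in\{1,2,3\}$, of the multiset over all vertices $w$ of the old colours of the triple in which $v_i$ is replaced by $w$. 3-WL *distinguishes* $G$ and $H$ if after some round their multisets of colours of triples differ. **Theorem.** The expressive power of BFC-$\delta$ is strictly upper bounded by 3-WL, for every $\delta$: 1. For all $\delta\in\mathbb N$ and all graphs $G,H$, and whatever colours, injective functions and searches are used: if BFC-$\delta$ distinguishes $G$ and $H$, then 3-WL distinguishes $G$ and $H$. 2. There are graphs $G,H$ that 3-WL distinguishes but that BFC-$\delta$ does not distinguish for any $\delta$, whatever colours, injective functions and searches are used. -/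

import Mathlib

/-! ## Breadth-first search -/

/-- The `δ`-neighbourhood `N_δ(v) = {u | 1 ≤ d(v,u) ≤ δ}`, with `d` the shortest-path distance
(`∞` between different connected components). -/
def nbhd {V : Type*} (G : SimpleGraph V) (δ : ℕ) (v : V) : Set V :=
  {u | 1 ≤ G.edist v u ∧ G.edist v u ≤ δ}

/-- The vertices visited by a search from the root `v` whose range is `δ` hops:
the root and its `δ`-neighbourhood. -/
def visited {V : Type*} (G : SimpleGraph V) (δ : ℕ) (v : V) : Set V :=
  insert v (nbhd G δ v)

/-- A breadth-first search from the root `v` with range `δ`, given by the times at which the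
visited vertices are discovered. All vertices of one level (distance from the root) are discovered
before those of the next level; ties inside a level may be broken in any way. -/
structure BFS {V : Type*} (G : SimpleGraph V) (δ : ℕ) (v : V) where
  time : V → ℕ
  time_injOn : Set.InjOn time (visited G δ v)
  level_lt : ∀ a ∈ visited G δ v, ∀ b ∈ visited G δ v,
    G.edist v a < G.edist v b → time a < time b

namespace BFS

variable {V : Type*} {G : SimpleGraph V} {δ : ℕ} {v : V}

/-- Tree edges `(a, b)`, directed from the earlier to the later vertex: `b` is discovered from `a`,
the first visited among the neighbours of `b`. -/
def treeEdges (T : BFS G δ v) : Set (V × V) :=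
  {e | e.1 ∈ visited G δ v ∧ e.2 ∈ visited G δ v ∧ G.Adj e.1 e.2 ∧ T.time e.1 < T.time e.2 ∧
    ∀ c ∈ visited G δ v, G.Adj c e.2 → T.time e.1 ≤ T.time c}

/-- Back edges `(a, b)`: the other edges between visited vertices, directed from the later to the
earlier vertex. -/
def backEdges (T : BFS G δ v) : Set (V × V) :=
  {e | e.1 ∈ visited G δ v ∧ e.2 ∈ visited G δ v ∧ G.Adj e.1 e.2 ∧ T.time e.2 < T.time e.1 ∧
    (e.2, e.1) ∉ T.treeEdges}

/-- Searches exist. -/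
theorem nonempty [Finite V] (G : SimpleGraph V) (δ : ℕ) (v : V) : Nonempty (BFS G δ v) := by
  obtain ⟨n, ⟨e⟩⟩ := Finite.exists_equiv_fin V
  refine ⟨⟨fun u => (G.edist v u).toNat * n + e u, ?_, ?_⟩⟩
  · intro a _ b _ h
    have h2 := congrArg (· % n) h
    simp only [Nat.mul_add_mod_self_right] at h2
    rw [Nat.mod_eq_of_lt (e a).2, Nat.mod_eq_of_lt (e b).2] at h2
    exact e.injective (Fin.ext h2)
  · intro a ha b hb h
    have fin : ∀ x ∈ visited G δ v, G.edist v x ≠ ⊤ := by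
      rintro x (rfl | hx)
      · simp
      · exact ne_top_of_le_ne_top (ENat.natCast_ne_top δ) hx.2
    have h1 : (G.edist v a).toNat < (G.edist v b).toNat := by
      rw [← ENat.natCast_toNat (fin a ha), ← ENat.natCast_toNat (fin b hb)] at h
      exact_mod_cast h
    have h2 := (e a).2
    have h3 : ((G.edist v a).toNat + 1) * n ≤ (G.edist v b).toNat * n :=
      Nat.mul_le_mul_right n h1
    rw [Nat.add_mul, Nat.one_mul] at h3
    omega

end BFS

/-! ## Breadth-first colouring -/

/-- The vertices from which `u` receives colours in the search rooted at `v`: its tree parent, and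
the earlier endpoints of those back edges at `u` that join different levels. -/
def etaBFC {V : Type*} (G : SimpleGraph V) (v u : V) (Etree Eback : Set (V × V)) : Set V :=
  {o | (o, u) ∈ Etree ∨ ((u, o) ∈ Eback ∧ G.edist v o ≠ G.edist v u)}

/-- A colour set `C` with an initial colour and injective update functions. -/
structure ColourScheme (C : Type*) where
  init : C
  ρ : C × Multiset C → C
  φ : C × C → C
  ψ : Multiset C → C
  ρ_inj : Function.Injective ρ
  φ_inj : Function.Injective φ
  ψ_inj : Function.Injective ψ

/-- Colour schemes exist. -/
theorem ColourScheme.nonempty : Nonempty (ColourScheme ℕ) :=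
  ⟨⟨0, Encodable.encode, Encodable.encode, Encodable.encode,
    Encodable.encode_injective, Encodable.encode_injective, Encodable.encode_injective⟩⟩

open Classical in
/-- The multiset of the values of `f` on the vertices in `s`. -/
noncomputable def colourMultiset {V C : Type*} [Fintype V] (s : Set V) (f : V → C) : Multiset C :=
  (Finset.univ.filter (· ∈ s)).val.map f

/-- The colours after `l` iterations of BFC-`δ`, given a search `T v` for every root `v`:
the first component is `u ↦ λ^l(u)`, the second is `v u ↦ λ_v^l(u)`. The recursion is
`λ_v^{l+1}(u) = φ(λ^l(u), ψ {{λ_v^l(w) : w ∈ η(u)}})` and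
`λ^{l+1}(u) = ρ(λ^l(u), {{λ_v^{l+1}(u) : v ∈ N_δ(u)}})`. -/
noncomputable def bfc {V C : Type*} [Fintype V] (S : ColourScheme C) (G : SimpleGraph V) (δ : ℕ)
    (T : ∀ v, BFS G δ v) : ℕ → (V → C) × (V → V → C)
  | 0 => (fun _ => S.init, fun _ _ => S.init)
  | l + 1 =>
    let old := bfc S G δ T l
    let rooted : V → V → C := fun v u =>
      S.φ (old.1 u,
        S.ψ (colourMultiset (etaBFC G v u (T v).treeEdges (T v).backEdges) (old.2 v)))
    (fun u => S.ρ (old.1 u, colourMultiset (nbhd G δ u) (fun v => rooted v u)), rooted)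

/-- BFC-`δ`, run with the searches `T` on `G` and `T'` on `H`, distinguishes `G` and `H`: after
some number of iterations their multisets of vertex colours differ (they then differ ever after,
as `ρ` is injective). -/
def BFCDistinguishes {V W C : Type*} [Fintype V] [Fintype W] (S : ColourScheme C) (δ : ℕ)
    (G : SimpleGraph V) (H : SimpleGraph W) (T : ∀ v, BFS G δ v) (T' : ∀ w, BFS H δ w) : Prop :=
  ∃ l : ℕ, Finset.univ.val.map (bfc S G δ T l).1 ≠ Finset.univ.val.map (bfc S H δ T' l).1

/-! ## The `k`-dimensional Weisfeiler-Leman test -/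

/-- The colours of `k`-tuples after `l` rounds. Initially the atomic type of the tuple; a new colour
is the old one together with one multiset of old colours for each of the `k` positions. -/
def WLColour (k : ℕ) : ℕ → Type
  | 0 => Fin k → Fin k → Prop × Prop
  | l + 1 => WLColour k l × (Fin k → Multiset (WLColour k l))

open Classical in
/-- `k`-WL (for `k ≥ 2`) in its standard, non-folklore form: the tuple `t` starts with its
equality and adjacency pattern, and in each round it collects, separately for each position `i`, the
multiset of the colours of the tuples got by replacing the `i`-th entry by a vertex `w`. -/
noncomputable def wl {V : Type*} [Fintype V] (G : SimpleGraph V) (k : ℕ) :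
    (l : ℕ) → (Fin k → V) → WLColour k l
  | 0 => fun t i j => (t i = t j, G.Adj (t i) (t j))
  | l + 1 => fun t =>
      (wl G k l t, fun i => Finset.univ.val.map fun w : V => wl G k l (Function.update t i w))

open Classical in
/-- `k`-WL distinguishes `G` and `H`: after some number of rounds their multisets of colours of
`k`-tuples differ. -/
def WLDistinguishes {V W : Type*} [Fintype V] [Fintype W] (k : ℕ)
    (G : SimpleGraph V) (H : SimpleGraph W) : Prop :=
  ∃ l : ℕ, (Finset.univ : Finset (Fin k → V)).val.map (wl G k l) ≠
    (Finset.univ : Finset (Fin k → W)).val.map (wl H k l)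

/-! The order of the search is irrelevant: in the search from `v`, a vertex `u` receives colours
exactly from its neighbours one step closer to `v` (`BFS.mem_etaBFC_iff`). Hence BFC colours agree
along any correspondence of pairs (root, vertex) that preserves distance and can be continued
bijectively to these predecessors and, for a fixed vertex, to all roots (`bfc_eq_of_matching`).

Upper bound: encode the pair (v, u) as the triple (v, u, u). The third entry is a scratch place,
where a neighbour of `u` is chosen and then copied over the second entry. So triples that 3-WL never
separates have the same walks, hence the same distances, and form such a correspondence.

Strictness: the complements of two disjoint 4-cycles and of an 8-cycle have diameter 2 and the same
numbers of vertices and of predecessors at each distance, so equality of distances is already such a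
correspondence. 3-WL sees that opposite vertices of a 4-cycle have two common neighbours, while
distinct vertices of an 8-cycle have at most one. -/

/-! ## Bijections from equal multisets of values -/

/-- Two families over finite types with the same multiset of values agree up to a bijection of the
index types. -/
theorem exists_equiv_of_map_univ_eq {V W C : Type*} [Fintype V] [Fintype W] {f : V → C} {g : W → C}
    (h : Finset.univ.val.map f = Finset.univ.val.map g) : ∃ σ : V ≃ W, ∀ v, f v = g (σ v) := by
  classical
  have key : ∀ c, Nonempty ({v // f v = c} ≃ {w // g w = c}) := by
    intro c
    rw [← Fintype.card_eq]
    have h2 := congrArg (Multiset.count c) h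
    rw [Multiset.count_map, Multiset.count_map, ← Finset.filter_val, ← Finset.filter_val,
      Finset.card_val, Finset.card_val] at h2
    simpa only [Fintype.card_subtype, eq_comm] using h2
  refine ⟨Equiv.ofFiberEquiv fun c => (key c).some, fun v => ?_⟩
  exact (Equiv.ofFiberEquiv_map (fun c => (key c).some) v).symm

theorem map_univ_eq_of_equiv {V W C : Type*} [Fintype V] [Fintype W] {f : V → C} {g : W → C}
    (σ : V ≃ W) (h : ∀ v, f v = g (σ v)) :
    Finset.univ.val.map f = Finset.univ.val.map g := by
  rw [← Finset.map_univ_equiv σ, Finset.map_val, Multiset.map_map]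
  exact Multiset.map_congr rfl fun v _ => h v

theorem colourMultiset_congr {V W C : Type*} [Fintype V] [Fintype W] {s : Set V} {t : Set W}
    {f : V → C} {g : W → C} (σ : V ≃ W) (hs : ∀ v, v ∈ s ↔ σ v ∈ t)
    (h : ∀ v ∈ s, f v = g (σ v)) : colourMultiset s f = colourMultiset t g := by
  classical
  have ht : Finset.univ.filter (· ∈ t) = (Finset.univ.filter (· ∈ s)).map σ.toEmbedding := by
    ext w
    obtain ⟨v, rfl⟩ := σ.surjective w
    simp [hs]
  unfold colourMultiset
  rw [ht, Finset.map_val, Multiset.map_map]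
  refine Multiset.map_congr rfl fun v hv => h v ?_
  simpa using hv

/-- If a relation that is antitone in `l` holds along a bijection for each `l`, then one bijection
works for all `l`. -/
theorem exists_equiv_forall_of_forall_exists {V W : Type*} [Finite V] [Finite W]
    {P : ℕ → V → W → Prop} (hP : ∀ l v w, P (l + 1) v w → P l v w)
    (h : ∀ l, ∃ σ : V ≃ W, ∀ v, P l v (σ v)) : ∃ σ : V ≃ W, ∀ v l, P l v (σ v) := by
  by_contra! hn
  choose v l hvl using hn
  -- There are finitely many bijections, so the levels at which they fail have a common bound `L`.
  obtain ⟨L, hL⟩ := (Set.finite_range l).bddAbove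
  obtain ⟨σ, hσ⟩ := h L
  have mono : ∀ n m, n ≤ m → ∀ v w, P m v w → P n v w := fun n m hnm v w => by
    induction hnm with
    | refl => exact id
    | step _ ih => exact fun h => ih (hP _ _ _ h)
  exact hvl σ (mono _ _ (hL ⟨σ, rfl⟩) _ _ (hσ _))

/-! ## Distances and breadth-first search -/

section search

variable {V : Type*} {G : SimpleGraph V} {δ : ℕ} {v u o : V}

/-- Take for `c` the second vertex of a shortest walk from `u` to `v`. -/
theorem exists_adj_edist_add_one (hne : u ≠ v) (hfin : G.edist v u ≠ ⊤) :
    ∃ c, G.Adj c u ∧ G.edist v c + 1 = G.edist v u := by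
  rw [SimpleGraph.edist_comm] at hfin
  obtain ⟨p, hp⟩ := SimpleGraph.exists_walk_of_edist_ne_top hfin
  cases p with
  | nil => exact absurd rfl hne
  | @cons _ c _ h q =>
    refine ⟨c, h.symm, le_antisymm ?_ ?_⟩
    · rw [SimpleGraph.edist_comm, SimpleGraph.edist_comm (u := v), ← hp]
      simpa using SimpleGraph.edist_le q
    · refine SimpleGraph.edist_triangle.trans (add_le_add le_rfl ?_)
      exact (SimpleGraph.edist_eq_one_iff_adj.2 h.symm).le

theorem mem_visited_iff : u ∈ visited G δ v ↔ G.edist v u ≤ δ := by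
  unfold visited nbhd
  rcases eq_or_ne u v with rfl | h
  · simp
  · have : 1 ≤ G.edist v u := Order.one_le_iff_pos.2 (SimpleGraph.edist_pos_of_ne h.symm)
    simp [h, this]

/-- In a breadth-first colouring a vertex receives colours exactly from its neighbours on the
previous level, whatever search is used. -/
theorem BFS.mem_etaBFC_iff (T : BFS G δ v) :
    o ∈ etaBFC G v u T.treeEdges T.backEdges ↔
      G.edist v u ≤ δ ∧ G.Adj o u ∧ G.edist v o + 1 = G.edist v u := by
  have fin : ∀ x, G.edist v x ≤ δ → G.edist v x ≠ ⊤ := fun x hx =>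
    ne_top_of_le_ne_top (ENat.natCast_ne_top δ) hx
  have le_of_time : ∀ a ∈ visited G δ v, ∀ b ∈ visited G δ v, T.time a < T.time b →
      G.edist v a ≤ G.edist v b := fun a ha b hb h => by
    by_contra! hlt
    exact absurd (T.level_lt b hb a ha hlt) h.not_gt
  have step : G.Adj o u → G.edist v o < G.edist v u → G.edist v o + 1 = G.edist v u := by
    intro hadj hlt
    refine le_antisymm (Order.add_one_le_of_lt hlt) ?_
    refine SimpleGraph.edist_triangle.trans (add_le_add le_rfl ?_)
    exact (SimpleGraph.edist_eq_one_iff_adj.2 hadj).le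
  constructor
  · rintro (⟨ho, hu, hadj, ht, hfirst⟩ | ⟨⟨hu, ho, hadj, ht, -⟩, hne⟩)
    · have hu' := mem_visited_iff.1 hu
      refine ⟨hu', hadj, step hadj ((le_of_time o ho u hu ht).lt_of_ne fun heq => ?_)⟩
      have huv : u ≠ v := by
        rintro rfl
        rw [SimpleGraph.edist_self, SimpleGraph.edist_eq_zero_iff] at heq
        exact hadj.ne heq.symm
      -- A tree parent on the level of `u` is impossible: the neighbour `c` on the previous level
      -- was visited before it.
      obtain ⟨c, hc, hcd⟩ := exists_adj_edist_add_one huv (fin u hu')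
      have hlt : G.edist v c < G.edist v u := by
        rw [← hcd]
        exact ENat.lt_add_one_iff (by intro h; rw [h] at hcd; exact fin u hu' hcd.symm) |>.2 le_rfl
      have hcv : c ∈ visited G δ v := mem_visited_iff.2 (hlt.le.trans hu')
      exact (hfirst c hcv hc).not_gt (T.level_lt c hcv o ho (heq ▸ hlt))
    · exact ⟨mem_visited_iff.1 hu, hadj.symm,
        step hadj.symm ((le_of_time o ho u hu ht).lt_of_ne hne)⟩
  · rintro ⟨hu', hadj, hd⟩
    have hlt : G.edist v o < G.edist v u := by
      rw [← hd]
      exact ENat.lt_add_one_iff (by intro h; rw [h] at hd; exact fin u hu' hd.symm) |>.2 le_rfl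
    have hu := mem_visited_iff.2 hu'
    have ho : o ∈ visited G δ v := mem_visited_iff.2 (hlt.le.trans hu')
    by_cases ht : (o, u) ∈ T.treeEdges
    · exact Or.inl ht
    · exact Or.inr ⟨⟨hu, ho, hadj.symm, T.level_lt o ho u hu hlt, ht⟩, hlt.ne⟩

end search

/-- Vertices whose neighbourhoods and shortest-path structures can be matched repeatedly get the
same breadth-first colours. -/
theorem bfc_eq_of_matching {V W C : Type*} [Fintype V] [Fintype W] (S : ColourScheme C) (δ : ℕ)
    {G : SimpleGraph V} {H : SimpleGraph W} (T : ∀ v, BFS G δ v) (T' : ∀ w, BFS H δ w)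
    (E : V → W → Prop) (D : V → V → W → W → Prop)
    (hE : ∀ u u', E u u' → ∃ σ : V ≃ W, ∀ v, D v u (σ v) u')
    (hDE : ∀ v u v' u', D v u v' u' → E u u')
    (hDd : ∀ v u v' u', D v u v' u' → G.edist v u = H.edist v' u')
    (hD : ∀ v u v' u', D v u v' u' → ∃ σ : V ≃ W, ∀ w,
      ((G.Adj w u ∧ G.edist v w + 1 = G.edist v u) ↔
        (H.Adj (σ w) u' ∧ H.edist v' (σ w) + 1 = H.edist v' u')) ∧
      (G.Adj w u ∧ G.edist v w + 1 = G.edist v u → D v w v' (σ w))) (l : ℕ) :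
    (∀ u u', E u u' → (bfc S G δ T l).1 u = (bfc S H δ T' l).1 u') ∧
      ∀ v u v' u', D v u v' u' → (bfc S G δ T l).2 v u = (bfc S H δ T' l).2 v' u' := by
  induction l with
  | zero => exact ⟨fun _ _ _ => rfl, fun _ _ _ _ _ => rfl⟩
  | succ l ih =>
    -- The rooted colours come first, since the new global colour uses those of the same round.
    have rooted : ∀ v u v' u', D v u v' u' →
        (bfc S G δ T (l + 1)).2 v u = (bfc S H δ T' (l + 1)).2 v' u' := by
      intro v u v' u' h
      obtain ⟨σ, hσ⟩ := hD v u v' u' h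
      have hm : colourMultiset (etaBFC G v u (T v).treeEdges (T v).backEdges)
            ((bfc S G δ T l).2 v) =
          colourMultiset (etaBFC H v' u' (T' v').treeEdges (T' v').backEdges)
            ((bfc S H δ T' l).2 v') := by
        refine colourMultiset_congr σ (fun w => ?_) fun w hw => ?_
        · rw [BFS.mem_etaBFC_iff, BFS.mem_etaBFC_iff, (hσ w).1, hDd v u v' u' h]
        · exact ih.2 _ _ _ _ ((hσ w).2 ((BFS.mem_etaBFC_iff _).1 hw).2)
      simp only [bfc]
      rw [hm, ih.1 u u' (hDE v u v' u' h)]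
    refine ⟨fun u u' h => ?_, rooted⟩
    obtain ⟨σ, hσ⟩ := hE u u' h
    have hm : colourMultiset (nbhd G δ u) (fun v => (bfc S G δ T (l + 1)).2 v u) =
        colourMultiset (nbhd H δ u') (fun v => (bfc S H δ T' (l + 1)).2 v u') := by
      refine colourMultiset_congr σ (fun v => ?_) fun v _ => rooted _ _ _ _ (hσ v)
      unfold nbhd
      rw [Set.mem_ofPred_eq, Set.mem_ofPred_eq, SimpleGraph.edist_comm, hDd _ _ _ _ (hσ v),
        SimpleGraph.edist_comm]
    simp only [bfc] at hm ⊢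
    rw [hm, ih.1 u u' h]

theorem not_bfcDistinguishes_of_equiv {V W C : Type*} [Fintype V] [Fintype W] {S : ColourScheme C}
    {δ : ℕ} {G : SimpleGraph V} {H : SimpleGraph W} {T : ∀ v, BFS G δ v} {T' : ∀ w, BFS H δ w}
    (τ : V ≃ W) (h : ∀ l u, (bfc S G δ T l).1 u = (bfc S H δ T' l).1 (τ u)) :
    ¬ BFCDistinguishes S δ G H T T' := fun ⟨l, hl⟩ => hl (map_univ_eq_of_equiv τ (h l))

/-! ## Tuples that the Weisfeiler-Leman test never separates -/

/-- `k`-WL gives the tuples `t` and `t'` the same colour in every round. -/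
def WLEquiv {V W : Type*} [Fintype V] [Fintype W] {k : ℕ} (G : SimpleGraph V) (H : SimpleGraph W)
    (t : Fin k → V) (t' : Fin k → W) : Prop :=
  ∀ l, wl G k l t = wl H k l t'

section wlEquiv

variable {V W : Type*} [Fintype V] [Fintype W] {G : SimpleGraph V} {H : SimpleGraph W}

theorem WLEquiv.symm {k : ℕ} {t : Fin k → V} {t' : Fin k → W} (h : WLEquiv G H t t') :
    WLEquiv H G t' t := fun l => (h l).symm

theorem WLEquiv.eq_iff {k : ℕ} {t : Fin k → V} {t' : Fin k → W} (h : WLEquiv G H t t')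
    (i j : Fin k) : t i = t j ↔ t' i = t' j :=
  iff_of_eq (congrArg Prod.fst (congrFun (congrFun (h 0) i) j))

theorem WLEquiv.adj_iff {k : ℕ} {t : Fin k → V} {t' : Fin k → W} (h : WLEquiv G H t t')
    (i j : Fin k) : G.Adj (t i) (t j) ↔ H.Adj (t' i) (t' j) :=
  iff_of_eq (congrArg Prod.snd (congrFun (congrFun (h 0) i) j))

/-- Each round gives its own bijection; as colours only get refined, finiteness yields one that
serves all rounds. -/
theorem WLEquiv.exists_equiv {k : ℕ} {t : Fin k → V} {t' : Fin k → W} (h : WLEquiv G H t t')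
    (i : Fin k) :
    ∃ σ : V ≃ W, ∀ w, WLEquiv G H (Function.update t i w) (Function.update t' i (σ w)) := by
  refine exists_equiv_forall_of_forall_exists
    (P := fun l w w' => wl G k l (Function.update t i w) = wl H k l (Function.update t' i w'))
    (fun l w w' hl => congrArg Prod.fst hl) fun l => ?_
  exact exists_equiv_of_map_univ_eq (congrFun (congrArg Prod.snd (h (l + 1))) i)

theorem exists_equiv_wlEquiv {k : ℕ} (h : ¬ WLDistinguishes k G H) :
    ∃ σ : (Fin k → V) ≃ (Fin k → W), ∀ t, WLEquiv G H t (σ t) := by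
  classical
  unfold WLDistinguishes at h
  push Not at h
  refine exists_equiv_forall_of_forall_exists
    (P := fun l t t' => wl G k l t = wl H k l t') (fun l t t' hl => congrArg Prod.fst hl)
    fun l => exists_equiv_of_map_univ_eq ?_
  convert h l

section triples

variable {a b c : V} {a' b' c' : W}

theorem WLEquiv.exists_equiv_fst (h : WLEquiv G H ![a, b, c] ![a', b', c']) :
    ∃ σ : V ≃ W, ∀ w, WLEquiv G H ![w, b, c] ![σ w, b', c'] := by
  obtain ⟨σ, hσ⟩ := h.exists_equiv 0
  refine ⟨σ, fun w => ?_⟩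
  have e1 : Function.update ![a, b, c] 0 w = ![w, b, c] := by
    ext i; fin_cases i <;> rfl
  have e2 : Function.update ![a', b', c'] 0 (σ w) = ![σ w, b', c'] := by
    ext i; fin_cases i <;> rfl
  exact e1 ▸ e2 ▸ hσ w

theorem WLEquiv.exists_equiv_snd (h : WLEquiv G H ![a, b, c] ![a', b', c']) :
    ∃ σ : V ≃ W, ∀ w, WLEquiv G H ![a, w, c] ![a', σ w, c'] := by
  obtain ⟨σ, hσ⟩ := h.exists_equiv 1
  refine ⟨σ, fun w => ?_⟩
  have e1 : Function.update ![a, b, c] 1 w = ![a, w, c] := by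
    ext i; fin_cases i <;> rfl
  have e2 : Function.update ![a', b', c'] 1 (σ w) = ![a', σ w, c'] := by
    ext i; fin_cases i <;> rfl
  exact e1 ▸ e2 ▸ hσ w

theorem WLEquiv.exists_equiv_thd (h : WLEquiv G H ![a, b, c] ![a', b', c']) :
    ∃ σ : V ≃ W, ∀ w, WLEquiv G H ![a, b, w] ![a', b', σ w] := by
  obtain ⟨σ, hσ⟩ := h.exists_equiv 2
  refine ⟨σ, fun w => ?_⟩
  have e1 : Function.update ![a, b, c] 2 w = ![a, b, w] := by
    ext i; fin_cases i <;> rfl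
  have e2 : Function.update ![a', b', c'] 2 (σ w) = ![a', b', σ w] := by
    ext i; fin_cases i <;> rfl
  exact e1 ▸ e2 ▸ hσ w

/-- Overwriting the first entry by the third. -/
theorem WLEquiv.thd_to_fst (h : WLEquiv G H ![a, b, c] ![a', b', c']) :
    WLEquiv G H ![c, b, c] ![c', b', c'] := by
  obtain ⟨σ, hσ⟩ := h.exists_equiv_fst
  -- The bijection must respect the equality of the first and third entries.
  have : σ c = c' := ((hσ c).eq_iff 0 2).1 rfl
  exact this ▸ hσ c

/-- Overwriting the second entry by the third. -/
theorem WLEquiv.thd_to_snd (h : WLEquiv G H ![a, b, c] ![a', b', c']) :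
    WLEquiv G H ![a, c, c] ![a', c', c'] := by
  obtain ⟨σ, hσ⟩ := h.exists_equiv_snd
  have : σ c = c' := ((hσ c).eq_iff 1 2).1 rfl
  exact this ▸ hσ c

/-- Induction along the walk, with `v` kept in place: the next vertex enters the third entry, where
its adjacency to the second is visible, and then replaces the second. -/
theorem WLEquiv.exists_walk {n : ℕ} {v u : V} {v' u' : W}
    (h : WLEquiv G H ![v, u, u] ![v', u', u']) (p : G.Walk u v) (hp : p.length = n) :
    ∃ q : H.Walk u' v', q.length = n := by
  induction n generalizing u u' with
  | zero =>
    have huv := SimpleGraph.Walk.eq_of_length_eq_zero hp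
    have : u' = v' := (h.eq_iff 1 0).1 huv
    subst this
    exact ⟨.nil, rfl⟩
  | succ n ih =>
    cases p with
    | nil => simp at hp
    | @cons _ x _ hadj p =>
      obtain ⟨σ, hσ⟩ := h.exists_equiv_thd
      have hadj' : H.Adj u' (σ x) := ((hσ x).adj_iff 1 2).1 hadj
      obtain ⟨q, hq⟩ := ih (hσ x).thd_to_snd p (by simpa using hp)
      exact ⟨.cons hadj' q, by simpa using hq⟩

theorem WLEquiv.edist_le {v u : V} {v' u' : W} (h : WLEquiv G H ![v, u, u] ![v', u', u']) :
    H.edist v' u' ≤ G.edist v u := by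
  rw [SimpleGraph.edist_comm, SimpleGraph.edist_comm (u := v)]
  refine le_iInf fun p => ?_
  obtain ⟨q, hq⟩ := h.exists_walk p rfl
  exact hq ▸ SimpleGraph.edist_le q

theorem WLEquiv.edist_eq {v u : V} {v' u' : W} (h : WLEquiv G H ![v, u, u] ![v', u', u']) :
    G.edist v u = H.edist v' u' := le_antisymm h.symm.edist_le h.edist_le

end triples

/-- The bijection of triples preserves equality patterns both ways, so it restricts to constant
triples. -/
theorem exists_equiv_wlEquiv_diagonal (h : ¬ WLDistinguishes 3 G H) :
    ∃ τ : V ≃ W, ∀ u, WLEquiv G H ![u, u, u] ![τ u, τ u, τ u] := by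
  obtain ⟨σ, hσ⟩ := exists_equiv_wlEquiv h
  have diag : ∀ u, ∃ u', σ ![u, u, u] = ![u', u', u'] := fun u => by
    refine ⟨σ ![u, u, u] 0, ?_⟩
    ext i
    fin_cases i
    · rfl
    · exact ((hσ ![u, u, u]).eq_iff 1 0).1 rfl
    · exact ((hσ ![u, u, u]).eq_iff 2 0).1 rfl
  choose τ hτ using diag
  refine ⟨Equiv.ofBijective τ ⟨fun x y hxy => ?_, fun y => ?_⟩, fun u => ?_⟩
  · have : σ ![x, x, x] = σ ![y, y, y] := by rw [hτ, hτ, hxy]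
    exact congrFun (σ.injective this) 0
  · obtain ⟨t, ht⟩ := σ.surjective ![y, y, y]
    have key : t = ![t 0, t 0, t 0] := by
      have ht' := ht ▸ hσ t
      ext i
      fin_cases i
      · rfl
      · exact (ht'.eq_iff 1 0).2 rfl
      · exact (ht'.eq_iff 2 0).2 rfl
    refine ⟨t 0, ?_⟩
    have h2 : ![τ (t 0), τ (t 0), τ (t 0)] = ![y, y, y] := by rw [← hτ, ← key, ht]
    exact congrFun h2 0
  · exact hτ u ▸ hσ ![u, u, u]

theorem wlDistinguishes_of_bfcDistinguishes {C : Type*} {S : ColourScheme C} {δ : ℕ}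
    {T : ∀ v, BFS G δ v} {T' : ∀ w, BFS H δ w} (h : BFCDistinguishes S δ G H T T') :
    WLDistinguishes 3 G H := by
  by_contra hn
  obtain ⟨τ, hτ⟩ := exists_equiv_wlEquiv_diagonal hn
  refine not_bfcDistinguishes_of_equiv τ (fun l u => ?_) h
  refine (bfc_eq_of_matching S δ T T' (fun u u' => WLEquiv G H ![u, u, u] ![u', u', u'])
    (fun v u v' u' => WLEquiv G H ![v, u, u] ![v', u', u'])
    (fun u u' hE => hE.exists_equiv_fst) (fun v u v' u' hD => hD.thd_to_fst)
    (fun v u v' u' hD => hD.edist_eq) (fun v u v' u' hD => ?_) l).1 u (τ u) (hτ u)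
  obtain ⟨σ, hσ⟩ := hD.exists_equiv_thd
  refine ⟨σ, fun w => ⟨?_, fun _ => (hσ w).thd_to_snd⟩⟩
  rw [(hσ w).thd_to_snd.edist_eq, hD.edist_eq]
  exact and_congr_left' ((hσ w).adj_iff 2 1)

end wlEquiv

/-! ## A pair of graphs on eight vertices -/

/-- The complement of the circulant graph on `ℤ/8` with connection set `{s, -s}`: the complement of
an 8-cycle for `s = 1`, of two disjoint 4-cycles for `s = 2`. -/
abbrev coCirculant (s : Fin 8) : SimpleGraph (Fin 8) :=
  (SimpleGraph.circulantGraph {s})ᶜ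

/-- The distance in `coCirculant s`, for `s = 1` and `s = 2`. -/
abbrev coCirculantDist (s v u : Fin 8) : ℕ :=
  if v = u then 0 else if (coCirculant s).Adj v u then 1 else 2

/-- Distinct nonadjacent vertices have a common neighbour, so the diameter is 2. -/
theorem edist_coCirculant {s : Fin 8} (hs : s = 1 ∨ s = 2) (v u : Fin 8) :
    (coCirculant s).edist v u =
      (coCirculantDist s v u : ℕ∞) := by
  unfold coCirculantDist
  split_ifs with h1 h2
  · simp [h1]
  · simpa using h2
  · have hw : ∃ w, (coCirculant s).Adj v w ∧ (coCirculant s).Adj w u := by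
      clear h2
      rcases hs with rfl | rfl <;> revert v u <;> decide
    obtain ⟨w, hvw, hwu⟩ := hw
    refine le_antisymm (SimpleGraph.edist_le (.cons hvw (.cons hwu .nil))) ?_
    have h0 := SimpleGraph.edist_pos_of_ne (G := coCirculant s) h1
    have h3 : (coCirculant s).edist v u ≠ 1 := fun h => h2 (by simpa using h)
    have h4 : 1 < (coCirculant s).edist v u :=
      lt_of_le_of_ne (Order.one_le_iff_pos.2 h0) h3.symm
    exact Order.add_one_le_of_lt h4

theorem coCirculant_spheres (u u' : Fin 8) :
    (Finset.univ.val.map fun v => coCirculantDist 2 v u) =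
      Finset.univ.val.map fun v => coCirculantDist 1 v u' := by
  revert u u'
  decide

/-- The square encodes the number of predecessors at distances 0, 1, 2: none, only the root, and
four common neighbours. -/
theorem coCirculant_predecessors {s : Fin 8} (hs : s = 1 ∨ s = 2) (v u : Fin 8) :
    (Finset.univ.val.map fun w => decide ((coCirculant s).Adj w u ∧
      coCirculantDist s v w + 1 = coCirculantDist s v u)) =
    Multiset.replicate (coCirculantDist s v u ^ 2) true +
      Multiset.replicate (8 - coCirculantDist s v u ^ 2) false := by
  rcases hs with rfl | rfl <;> revert v u <;> decide

theorem not_bfcDistinguishes_coCirculant {C : Type*} {S : ColourScheme C} {δ : ℕ}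
    {T : ∀ v, BFS (coCirculant 2) δ v} {T' : ∀ w, BFS (coCirculant 1) δ w} :
    ¬ BFCDistinguishes S δ (coCirculant 2) (coCirculant 1) T T' := by
  refine not_bfcDistinguishes_of_equiv (Equiv.refl _) fun l u => ?_
  refine (bfc_eq_of_matching S δ T T' (fun _ _ => True)
    (fun v u v' u' => (coCirculant 2).edist v u = (coCirculant 1).edist v' u')
    (fun u u' _ => ?_) (fun _ _ _ _ _ => trivial) (fun _ _ _ _ h => h)
    (fun v u v' u' h => ?_) l).1 u _ trivial
  · obtain ⟨σ, hσ⟩ := exists_equiv_of_map_univ_eq (coCirculant_spheres u u')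
    refine ⟨σ, fun v => ?_⟩
    rw [edist_coCirculant (.inr rfl), edist_coCirculant (.inl rfl), Nat.cast_inj]
    exact hσ v
  · have h' := h
    rw [edist_coCirculant (.inr rfl), edist_coCirculant (.inl rfl), Nat.cast_inj] at h'
    obtain ⟨σ, hσ⟩ := exists_equiv_of_map_univ_eq <|
      (coCirculant_predecessors (.inr rfl) v u).trans <|
        (by rw [h'] : _ = _).trans (coCirculant_predecessors (.inl rfl) v' u').symm
    have key : ∀ w, ((coCirculant 2).Adj w u ∧
        (coCirculant 2).edist v w + 1 = (coCirculant 2).edist v u) ↔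
        ((coCirculant 1).Adj (σ w) u' ∧
          (coCirculant 1).edist v' (σ w) + 1 = (coCirculant 1).edist v' u') := by
      intro w
      simp only [edist_coCirculant (s := 2) (.inr rfl), edist_coCirculant (s := 1) (.inl rfl)]
      exact_mod_cast decide_eq_decide.1 (hσ w)
    refine ⟨σ, fun w => ⟨key w, fun hw => ?_⟩⟩
    -- Matched predecessors both lie one step closer to their roots, so their distances agree.
    have h1 := hw.2.trans (h.trans ((key w).1 hw).2.symm)
    exact WithTop.add_right_cancel ENat.one_ne_top h1

set_option synthInstance.maxHeartbeats 200000 in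
set_option synthInstance.maxSize 1000 in
set_option maxRecDepth 10000 in
theorem wlDistinguishes_coCirculant : WLDistinguishes 3 (coCirculant 2) (coCirculant 1) := by
  by_contra hn
  obtain ⟨τ, hτ⟩ := exists_equiv_wlEquiv_diagonal hn
  -- 0 and 4 are opposite in the 4-cycle 0, 2, 4, 6, with common cycle neighbours 2 and 6.
  obtain ⟨σ, hσ⟩ := (hτ 0).exists_equiv_snd
  obtain ⟨υ, hυ⟩ := (hσ 4).exists_equiv_thd
  -- In the 8-cycle two distinct vertices have at most one common neighbour, which forces the images
  -- of 2 and 6 to coincide.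
  have key : ∀ a b : Fin 8, a ≠ b → ∀ x, a ≠ x → b ≠ x → ¬ (coCirculant 1).Adj a x →
      ¬ (coCirculant 1).Adj b x → ∀ y, a ≠ y → b ≠ y → ¬ (coCirculant 1).Adj a y →
      ¬ (coCirculant 1).Adj b y → x = y := by
    decide
  have ne : ∀ w (i j : Fin 3), ![0, 4, w] i ≠ ![0, 4, w] j →
      ![τ 0, σ 4, υ w] i ≠ ![τ 0, σ 4, υ w] j := fun w i j h => ((hυ w).eq_iff i j).not.1 h
  have nadj : ∀ w (i j : Fin 3), ¬ (coCirculant 2).Adj (![0, 4, w] i) (![0, 4, w] j) →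
      ¬ (coCirculant 1).Adj (![τ 0, σ 4, υ w] i) (![τ 0, σ 4, υ w] j) :=
    fun w i j h => ((hυ w).adj_iff i j).not.1 h
  have h26 : υ 2 = υ 6 := key (τ 0) (σ 4) (ne 2 0 1 (by decide))
    _ (ne 2 0 2 (by decide)) (ne 2 1 2 (by decide)) (nadj 2 0 2 (by decide)) (nadj 2 1 2 (by decide))
    _ (ne 6 0 2 (by decide)) (ne 6 1 2 (by decide)) (nadj 6 0 2 (by decide)) (nadj 6 1 2 (by decide))
  exact absurd (υ.injective h26) (by decide)

theorem mainTheorem1 :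
    (∀ (δ : ℕ) (V : Type*) (W : Type*) [Fintype V] [Fintype W]
        (G : SimpleGraph V) (H : SimpleGraph W)
        (C : Type*) (S : ColourScheme C) (T : ∀ v, BFS G δ v) (T' : ∀ w, BFS H δ w),
        BFCDistinguishes S δ G H T T' → WLDistinguishes 3 G H) ∧
      ∃ (n : ℕ) (G H : SimpleGraph (Fin n)), WLDistinguishes 3 G H ∧
        ∀ (δ : ℕ) (C : Type*) (S : ColourScheme C) (T : ∀ v, BFS G δ v) (T' : ∀ w, BFS H δ w),
          ¬ BFCDistinguishes S δ G H T T' :=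
  ⟨fun _ _ _ _ _ _ _ _ _ _ _ h => wlDistinguishes_of_bfcDistinguishes h,
    8, coCirculant 2, coCirculant 1, wlDistinguishes_coCirculant,
    fun _ _ _ _ _ => not_bfcDistinguishes_coCirculant⟩
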